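/- Let $D,L\ge 1$ be integers and let $\Lambda$ be the $D$-dimensional cubic lattice of linear size $L$: its $L^D$ sites are the points of $\{0,\dots,L-1\}^D$, each direction has either an open or a periodic boundary condition, distances are Euclidean with unit lattice spacing, and each site carries one qubit. Let $\Pi\subseteq(\mathbb C^2)^{\otimes\Lambda}$ be a subspace (a code) with $\dim\Pi>1$, let $\delta\in\mathbb R$, and let $\ell\ge1$ be a real number. For density matrices let $\mathfrak F(\rho,\sigma)=\operatorname{Tr}\sqrt{\sqrt\sigma\,\rho\,\sqrt\sigma}$ and $\mathfrak B(\rho,\sigma)=\sqrt{1-\mathfrak F(\rho,\sigma)}$ (Bures distance). For a region $A\subseteq\Lambda$ let $A^{+\ell}$ be the set of all sites within distance $\ell$ of $A$, let $B=A^{+\ell}\setminus A$, and let $C=\Lambda\setminus A^{+\ell}$. The region $A$ is called $(\delta,\ell)$-correctable on $\Pi$ if there is a quantum channel (a completely positive trace-preserving map) $\mathcal R_B^{AB}$ from the operators on $B$ to the operators on $AB$ such that $$\mathfrak B\bigl((\mathcal R_B^{AB}\otimes\mathrm{id}_{CR})(\rho^{BCR}),\ \rho^{ABCR}\bigr)\le\delta$$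 for every density matrix $\rho^{ABC}$ supported on $\Pi$ and every purification $\rho^{ABCR}$ of it by a finite-dimensional system $R$, where $\rho^{BCR}=\operatorname{Tr}_A\rho^{ABCR}$. The code distance of $\Pi$ (as a $(\delta,\ell)$-correctable code) is the largest integer $d\ge 0$ such that every region $A\subseteq\Lambda$ with $|A|<d$ is $(\delta,\ell)$-correctable on $\Pi$, whenever such a largest integer exists. Suppose that $10L\delta<\ell$. Then the code distance $d$, whenever it exists, satisfies $$d\le 5\,\ell\,L^{D-1}.$$ Moreover, the code distance exists whenever $\ell\le L$. -/

import Mathlib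

open scoped MatrixOrder ComplexOrder

namespace LocalAQEC

noncomputable section

/-! ### States, fidelity, channels -/

section States

variable {m n r : Type*}

/-- The rank-one operator `|ψ⟩⟨ψ|`. -/
def ketbra (ψ : m → ℂ) : Matrix m m ℂ :=
  Matrix.vecMulVec ψ (star ψ)

/-- Density matrices: positive semidefinite of trace one. -/
def IsDensity [Fintype m] (ρ : Matrix m m ℂ) : Prop :=
  ρ.PosSemidef ∧ ρ.trace = 1

/-- The fidelity `F(ρ, σ) = Tr √(√σ ρ √σ)`. -/
def fidelity [Fintype m] [DecidableEq m] (ρ σ : Matrix m m ℂ) : ℝ :=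
  (CFC.sqrt (CFC.sqrt σ * ρ * CFC.sqrt σ)).trace.re

/-- The Bures distance `B(ρ, σ) = √(1 - F(ρ, σ))`. -/
def bures [Fintype m] [DecidableEq m] (ρ σ : Matrix m m ℂ) : ℝ :=
  Real.sqrt (1 - fidelity ρ σ)

/-- The map `Φ ⊗ id` on operators of the system `m × r`, where `Φ` acts on operators of `m`. -/
def tensorId (Φ : Matrix m m ℂ →ₗ[ℂ] Matrix n n ℂ) (X : Matrix (m × r) (m × r) ℂ) :
    Matrix (n × r) (n × r) ℂ :=
  Matrix.of fun p q => Φ (Matrix.of fun i j => X (i, p.2) (j, q.2)) p.1 q.1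

/-- Quantum channels: completely positive and trace-preserving linear maps. -/
def IsChannel [Fintype m] [Fintype n] (Φ : Matrix m m ℂ →ₗ[ℂ] Matrix n n ℂ) : Prop :=
  (∀ (k : ℕ) (X : Matrix (m × Fin k) (m × Fin k) ℂ), X.PosSemidef → (tensorId Φ X).PosSemidef) ∧
    ∀ X : Matrix m m ℂ, (Φ X).trace = X.trace

end States

/-! ### Qubits on a finite set of sites, codes, purifications -/

section Codes

variable {V : Type*} [Fintype V] [DecidableEq V]

/-- The computational basis of the Hilbert space of the qubits in the region `S`. -/
abbrev Conf (S : Finset V) : Type _ := ↥S → Fin 2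

/-- The basis state of all qubits which is `x` on `N` and `c` on the complement of `N`. -/
def glue₂ (N : Finset V) (x : Conf N) (c : Conf Nᶜ) : V → Fin 2 := fun v =>
  if h : v ∈ N then x ⟨v, h⟩ else c ⟨v, Finset.mem_compl.2 h⟩

/-- For `A ⊆ N`: the basis state of all qubits which is `a` on `A`, `b` on `N \ A` and
`c` on the complement of `N`. -/
def glue₃ (A N : Finset V) (a : Conf A) (b : Conf (N \ A)) (c : Conf Nᶜ) : V → Fin 2 := fun v =>
  if hN : v ∈ N then
    if hA : v ∈ A then a ⟨v, hA⟩ else b ⟨v, Finset.mem_sdiff.2 ⟨hN, hA⟩⟩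
  else c ⟨v, Finset.mem_compl.2 hN⟩

/-- A code is a subspace of the Hilbert space of all qubits. -/
abbrev Code (V : Type*) : Type _ := Submodule ℂ ((V → Fin 2) → ℂ)

/-- `ρ` is a code state: a density matrix with `ρ = Πρ = ρΠ` for the orthogonal projector `Π` onto
the code space. As `ρ` is Hermitian, this means that its range is contained in the code space. -/
def IsCodeState (C : Code V) (ρ : Matrix (V → Fin 2) (V → Fin 2) ℂ) : Prop :=
  IsDensity ρ ∧ ∀ v, ρ.mulVec v ∈ C

/-- `ψ` is a purification of `ρ` with an `r`-dimensional purifying system `R`, that is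
`ρ = Tr_R |ψ⟩⟨ψ|`. -/
def IsPurification {r : ℕ} (ψ : (V → Fin 2) × Fin r → ℂ)
    (ρ : Matrix (V → Fin 2) (V → Fin 2) ℂ) : Prop :=
  ∀ x y, ρ x y = ∑ s, ketbra ψ (x, s) (y, s)

/-- For `A ⊆ N` write `B = N \ A` and `C` for the complement of `N`. From an operator on `ABCR`, its
partial trace over `A`, as an operator on `B ⊗ (CR)`. -/
def erase (A N : Finset V) {r : ℕ}
    (X : Matrix ((V → Fin 2) × Fin r) ((V → Fin 2) × Fin r) ℂ) :
    Matrix (Conf (N \ A) × (Conf Nᶜ × Fin r)) (Conf (N \ A) × (Conf Nᶜ × Fin r)) ℂ :=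
  Matrix.of fun p q =>
    ∑ a : Conf A, X (glue₃ A N a p.1 p.2.1, p.2.2) (glue₃ A N a q.1 q.2.1, q.2.2)

/-- An operator on `ABCR`, viewed as an operator on `(AB) ⊗ (CR)`, where `AB = N`. -/
def split (N : Finset V) {r : ℕ}
    (X : Matrix ((V → Fin 2) × Fin r) ((V → Fin 2) × Fin r) ℂ) :
    Matrix (Conf N × (Conf Nᶜ × Fin r)) (Conf N × (Conf Nᶜ × Fin r)) ℂ :=
  X.submatrix (fun p => (glue₂ N p.1 p.2.1, p.2.2)) (fun p => (glue₂ N p.1 p.2.1, p.2.2))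

/-- With `B = N \ A`: there is a recovery channel from `B` to `AB = N` that restores, up to Bures
distance `δ`, every purified code state from which the region `A` has been erased. -/
def IsRecoverable (C : Code V) (δ : ℝ) (A N : Finset V) : Prop :=
  ∃ Φ : Matrix (Conf (N \ A)) (Conf (N \ A)) ℂ →ₗ[ℂ] Matrix (Conf N) (Conf N) ℂ,
    IsChannel Φ ∧
      ∀ ρ, IsCodeState C ρ → ∀ (r : ℕ) (ψ : (V → Fin 2) × Fin r → ℂ), IsPurification ψ ρ →
        bures (tensorId Φ (erase A N (ketbra ψ))) (split N (ketbra ψ)) ≤ δ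

end Codes

/-! ### The lattice -/

section Lattice

variable {D L : ℕ}

/-- The sites of the `D`-dimensional cubic lattice of linear size `L`. -/
abbrev Site (D L : ℕ) : Type := Fin D → Fin L

/-- Distance of two coordinates: on a segment of `L` sites, or (if `periodic` holds) on a cycle of
`L` sites. -/
def coordDist (periodic : Bool) (i j : Fin L) : ℕ :=
  if periodic then min (Nat.dist i j) (L - Nat.dist i j) else Nat.dist i j

/-- The Euclidean distance of two sites; each direction has an open or a periodic boundary
condition. -/
def siteDist (periodic : Fin D → Bool) (x y : Site D L) : ℝ :=
  Real.sqrt (∑ i, (coordDist (periodic i) (x i) (y i) : ℝ) ^ 2)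

open Classical in
/-- The region `A^{+ℓ}` of all sites within distance `ℓ` of `A`. -/
def nbhd (periodic : Fin D → Bool) (ℓ : ℝ) (A : Finset (Site D L)) : Finset (Site D L) :=
  Finset.univ.filter fun y => ∃ x ∈ A, siteDist periodic x y ≤ ℓ

/-- The region `A` is `(δ, ℓ)`-correctable on the code `C`. -/
def IsCorrectable (periodic : Fin D → Bool) (C : Code (Site D L)) (δ ℓ : ℝ)
    (A : Finset (Site D L)) : Prop :=
  IsRecoverable C δ A (nbhd periodic ℓ A)

/-- The code distance of the `(δ, ℓ)`-correctable code `C` is `d`: the largest integer such that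
every region of size less than `d` is `(δ, ℓ)`-correctable. -/
def IsCodeDistance (periodic : Fin D → Bool) (C : Code (Site D L)) (δ ℓ : ℝ) (d : ℕ) : Prop :=
  IsGreatest {d : ℕ | ∀ A : Finset (Site D L), A.card < d → IsCorrectable periodic C δ ℓ A} d

end Lattice

end

end LocalAQEC

open LocalAQEC

set_option linter.unusedSectionVars false

namespace LocalAQEC

open Matrix

/-! Recovery makes operators movable. If a region `A` is correctable, the adjoint of "erase `A`,
then recover" turns an effect (`0 ≤ M ≤ 1`) into an effect that acts trivially on `A` and has nearly
the same expectation in every pure code state; the error is linear in `δ`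
(`IsRecoverable.exists_heisenberg`). This adjoint only disturbs the `ℓ`-neighbourhood of `A`, so
correctable regions that avoid each other's neighbourhoods can be cleaned one after another, with
errors adding up (`isCleanable_biUnion`).

If `d > 5ℓL^(D-1)`, slabs of width about `4ℓ` are correctable. Cut the lattice into `2N` such slabs.
Those of one parity are pairwise more than `ℓ` apart, so every effect can be cleaned off the even
slabs, and likewise off the odd ones. Clean `|a⟩⟨a|` off one family and the projector on `a + b` off
the other, for orthonormal code vectors `a`, `b`. The two resulting effects have disjoint supports,
hence commute, yet one distinguishes `a` from `b` and the other `a + b` from `a - b`. For small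
errors this contradicts `commuting_effects_tradeoff`. There are `O(L/ℓ)` slabs, so `10Lδ < ℓ` keeps
the total error bounded. -/

/-- Effects: operators `M` with `0 ≤ M ≤ 1`. -/
def IsEffect {n : Type*} [DecidableEq n] (M : Matrix n n ℂ) : Prop :=
  M.PosSemidef ∧ (1 - M).PosSemidef

theorem IsEffect.compl {n : Type*} [DecidableEq n] {M : Matrix n n ℂ} (hM : IsEffect M) : IsEffect (1 - M) :=
  ⟨hM.2, by simpa using hM.1⟩

/-! ### Quadratic forms of effects and the tradeoff for commuting effects -/

section Contractions

variable {n : Type*} [Fintype n]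

/-- The real part of the sesquilinear form `⟨a|M|b⟩`. -/
noncomputable def sandwich (M : Matrix n n ℂ) (a b : n → ℂ) : ℝ :=
  (star a ⬝ᵥ M *ᵥ b).re

theorem sandwich_sub_left (M N : Matrix n n ℂ) (a b : n → ℂ) :
    sandwich (M - N) a b = sandwich M a b - sandwich N a b := by
  simp [sandwich, sub_mulVec, dotProduct_sub]

theorem sandwich_add_mid (M : Matrix n n ℂ) (a a' b : n → ℂ) :
    sandwich M (a + a') b = sandwich M a b + sandwich M a' b := by
  simp [sandwich, add_dotProduct]

theorem sandwich_add_right (M : Matrix n n ℂ) (a b b' : n → ℂ) :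
    sandwich M a (b + b') = sandwich M a b + sandwich M a b' := by
  simp [sandwich, mulVec_add, dotProduct_add]

theorem sandwich_smul_mid (M : Matrix n n ℂ) (s : ℝ) (a b : n → ℂ) :
    sandwich M ((s : ℂ) • a) b = s * sandwich M a b := by
  simp [sandwich, smul_dotProduct]

theorem sandwich_smul_right (M : Matrix n n ℂ) (s : ℝ) (a b : n → ℂ) :
    sandwich M a ((s : ℂ) • b) = s * sandwich M a b := by
  simp [sandwich, mulVec_smul, dotProduct_smul]

theorem sandwich_comm {M : Matrix n n ℂ} (hM : M.IsHermitian) (a b : n → ℂ) :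
    sandwich M b a = sandwich M a b := by
  have h : star (star a ⬝ᵥ M *ᵥ b) = star b ⬝ᵥ M *ᵥ a := by
    rw [star_dotProduct, star_star, star_mulVec, hM.eq, dotProduct_mulVec]
  unfold sandwich
  rw [← h]
  simp

theorem sandwich_self_nonneg {M : Matrix n n ℂ} (hM : M.PosSemidef) (a : n → ℂ) :
    0 ≤ sandwich M a a :=
  (Complex.le_def.1 (hM.dotProduct_mulVec_nonneg a)).1

theorem trace_mul_ketbra (M : Matrix n n ℂ) (a : n → ℂ) :
    (M * ketbra a).trace = star a ⬝ᵥ M *ᵥ a := by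
  rw [ketbra, mul_vecMulVec, trace_vecMulVec, dotProduct_comm]

theorem ketbra_posSemidef (a : n → ℂ) : (ketbra a).PosSemidef :=
  posSemidef_vecMulVec_self_star a

theorem sandwich_ketbra (a b : n → ℂ) :
    sandwich (ketbra a) b b = Complex.normSq (star a ⬝ᵥ b) := by
  have h : star (star a ⬝ᵥ b) = star b ⬝ᵥ a := by rw [star_dotProduct, star_star]
  rw [sandwich, ketbra, vecMulVec_mulVec, dotProduct_smul, ← h]
  simp [Complex.normSq_apply]

/-- Weighted Cauchy–Schwarz inequality: expand the form at `u • a + b` with `u = ∓s` and divide by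
`s`. -/
theorem two_mul_sandwich_le {R : Matrix n n ℂ} (hR : R.PosSemidef) {s : ℝ} (hs : 0 < s)
    (a b : n → ℂ) :
    2 * sandwich R a b ≤ s * sandwich R a a + s⁻¹ * sandwich R b b ∧
      -(2 * sandwich R a b) ≤ s * sandwich R a a + s⁻¹ * sandwich R b b := by
  have key : ∀ u : ℝ, 0 ≤ u ^ 2 * sandwich R a a + 2 * u * sandwich R a b + sandwich R b b := by
    intro u
    have h := sandwich_self_nonneg hR ((u : ℂ) • a + b)
    simp only [sandwich_add_mid, sandwich_add_right, sandwich_smul_mid, sandwich_smul_right,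
      sandwich_comm hR.isHermitian a b] at h
    linarith
  have e : s * sandwich R a a + s⁻¹ * sandwich R b b
      = s⁻¹ * (s ^ 2 * sandwich R a a + sandwich R b b) := by
    field_simp
  have hs' : 0 < s⁻¹ := inv_pos.2 hs
  constructor
  · have h := mul_nonneg hs'.le (key (-s))
    have : s⁻¹ * (2 * s * sandwich R a b) = 2 * sandwich R a b := by field_simp
    nlinarith
  · have h := mul_nonneg hs'.le (key s)
    have : s⁻¹ * (2 * s * sandwich R a b) = 2 * sandwich R a b := by field_simp
    nlinarith

variable [DecidableEq n]

theorem trace_mul_nonneg {M N : Matrix n n ℂ} (hM : M.PosSemidef) (hN : N.PosSemidef) :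
    0 ≤ (M * N).trace := by
  obtain ⟨B, hB⟩ := CStarAlgebra.nonneg_iff_eq_star_mul_self.1 (nonneg_iff_posSemidef.2 hM)
  rw [hB, mul_assoc, trace_mul_comm]
  exact (hN.mul_mul_conjTranspose_same B).trace_nonneg

theorem re_trace_mul_nonneg {M N : Matrix n n ℂ} (hM : M.PosSemidef) (hN : N.PosSemidef) :
    0 ≤ (M * N).trace.re :=
  (Complex.le_def.1 (trace_mul_nonneg hM hN)).1

theorem isEffect_ketbra {a : n → ℂ} (ha : star a ⬝ᵥ a = 1) : IsEffect (ketbra a) := by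
  refine ⟨ketbra_posSemidef a, ?_⟩
  have hh : (1 - ketbra a).IsHermitian := isHermitian_one.sub (ketbra_posSemidef a).isHermitian
  have hi : ketbra a * ketbra a = ketbra a := by
    simp [ketbra, vecMulVec_mul_vecMulVec, ha]
  have h2 : (1 - ketbra a)ᴴ * (1 - ketbra a) = 1 - ketbra a := by
    rw [hh.eq, sub_mul, mul_sub, mul_sub, hi]
    simp
  rw [← h2]
  exact posSemidef_conjTranspose_mul_self _

theorem posSemidef_mul_of_commute {M N : Matrix n n ℂ} (hM : M.PosSemidef) (hN : N.PosSemidef)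
    (h : Commute M N) : (M * N).PosSemidef :=
  nonneg_iff_posSemidef.1
    (Commute.mul_nonneg (nonneg_iff_posSemidef.2 hM) (nonneg_iff_posSemidef.2 hN) h)

theorem sandwich_one (a b : n → ℂ) : sandwich 1 a b = (star a ⬝ᵥ b).re := by
  simp [sandwich]

/-- Commuting effects cannot both distinguish `a` from `b` and `a + b` from `a - b` well. -/
theorem commuting_effects_tradeoff {P Q : Matrix n n ℂ} (hP : IsEffect P) (hQ : IsEffect Q)
    (hPQ : Commute P Q) {a b : n → ℂ} (ha : star a ⬝ᵥ a = 1) (hb : star b ⬝ᵥ b = 1)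
    (hab : star a ⬝ᵥ b = 0) {ε₁ ε₂ : ℝ} (hQa : 1 - ε₁ ≤ sandwich Q a a)
    (hQb : sandwich Q b b ≤ ε₁) (hPab : 1 - 2 * ε₂ ≤ 2 * sandwich P a b) :
    2 ≤ 9 * ε₁ + 6 * ε₂ := by
  have c1 : Commute (1 - P) Q := (Commute.one_left Q).sub_left hPQ
  have c2 : Commute P (1 - Q) := (Commute.one_right P).sub_right hPQ
  have c3 : Commute (1 - P) (1 - Q) := (Commute.one_right _).sub_right c1
  -- The four products of `P` or `1 - P` with `Q` or `1 - Q` are positive and sum to `1`. The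
  -- weights `1/3` and `3` suit that `Q` is large at `a` and small at `b`. The sum of the four
  -- bounds is `4⟨a|P|b⟩ ≤ 2/3 + (8/3)(⟨a|1-Q|a⟩ + ⟨b|Q|b⟩)`, where `⟨a|b⟩ = 0` removes the constant
  -- term on the left.
  have h0 := (two_mul_sandwich_le (posSemidef_mul_of_commute hP.1 hQ.1 hPQ)
    (s := 1 / 3) (by norm_num) a b).1
  have h1 := (two_mul_sandwich_le (posSemidef_mul_of_commute hP.2 hQ.1 c1)
    (s := 1 / 3) (by norm_num) a b).2
  have h2 := (two_mul_sandwich_le (posSemidef_mul_of_commute hP.1 hQ.2 c2)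
    (s := 3) (by norm_num) a b).1
  have h3 := (two_mul_sandwich_le (posSemidef_mul_of_commute hP.2 hQ.2 c3)
    (s := 3) (by norm_num) a b).2
  have na := sandwich_self_nonneg hQ.2 a
  have nb := sandwich_self_nonneg hQ.1 b
  have i1 : sandwich 1 a a = 1 := by rw [sandwich_one, ha]; rfl
  have i2 : sandwich 1 b b = 1 := by rw [sandwich_one, hb]; rfl
  have i3 : sandwich 1 a b = 0 := by rw [sandwich_one, hab]; rfl
  simp only [sub_mul, mul_sub, one_mul, mul_one, sandwich_sub_left, i1, i2, i3] at h0 h1 h2 h3 na nb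
  norm_num at h0 h1 h2 h3
  linarith

end Contractions

/-! ### From Bures distance to expectations of effects -/

section Fidelity

variable {n : Type*} [Fintype n] [DecidableEq n]

/-- A rank-one projector is its own square root and compresses `ρ` to a multiple of itself. -/
theorem fidelity_ketbra {ρ : Matrix n n ℂ} (hρ : ρ.PosSemidef) {φ : n → ℂ}
    (hφ : star φ ⬝ᵥ φ = 1) : fidelity ρ (ketbra φ) = Real.sqrt (sandwich ρ φ φ) := by
  have hi : ketbra φ * ketbra φ = ketbra φ := by
    simp [ketbra, vecMulVec_mul_vecMulVec, hφ]
  have hp : 0 ≤ ketbra φ := nonneg_iff_posSemidef.2 (ketbra_posSemidef φ)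
  have hs : CFC.sqrt (ketbra φ) = ketbra φ := CFC.sqrt_unique hi hp
  set p := sandwich ρ φ φ with hpdef
  have hp0 : 0 ≤ p := sandwich_self_nonneg hρ φ
  have hc : star φ ⬝ᵥ ρ *ᵥ φ = (p : ℂ) := by
    have h := Complex.le_def.1 (hρ.dotProduct_mulVec_nonneg φ)
    exact Complex.ext rfl (by simpa using h.2.symm)
  have hm : ketbra φ * ρ * ketbra φ = (p : ℂ) • ketbra φ := by
    rw [mul_assoc]
    unfold ketbra
    rw [mul_vecMulVec, vecMulVec_mul_vecMulVec, hc]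
    simp [vecMulVec_smul]
  have hr : CFC.sqrt ((p : ℂ) • ketbra φ) = ((Real.sqrt p : ℝ) : ℂ) • ketbra φ := by
    refine CFC.sqrt_unique ?_ ?_
    · rw [smul_mul_smul_comm, hi, ← Complex.ofReal_mul, Real.mul_self_sqrt hp0]
    · exact nonneg_iff_posSemidef.2 ((ketbra_posSemidef φ).smul
        (by exact_mod_cast Real.sqrt_nonneg p))
  have ht : (ketbra φ).trace = 1 := by
    rw [ketbra, trace_vecMulVec, dotProduct_comm, hφ]
  rw [fidelity, hs, hm, hr, trace_smul, ht]
  simp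

theorem one_sub_le_sandwich_of_bures_le {ρ : Matrix n n ℂ} (hρ : ρ.PosSemidef) {φ : n → ℂ}
    (hφ : star φ ⬝ᵥ φ = 1) {ε : ℝ} (hε : ε ≤ 1) (h : bures ρ (ketbra φ) ≤ ε) :
    1 - 2 * ε ^ 2 ≤ sandwich ρ φ φ := by
  rw [bures, fidelity_ketbra hρ hφ] at h
  have h0 : 0 ≤ ε := (Real.sqrt_nonneg _).trans h
  have h1 := (Real.sqrt_le_left h0).1 h
  have h2 := Real.sq_sqrt (sandwich_self_nonneg hρ φ)
  have h3 : 0 ≤ 1 - ε ^ 2 := by nlinarith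
  nlinarith [sq_nonneg (ε ^ 2)]

/-- An effect has nearly the same expectation in a pure state and in a state close to it. -/
theorem sandwich_sub_trace_le {ρ O : Matrix n n ℂ} (hρ : IsDensity ρ) (hO : IsEffect O)
    {φ : n → ℂ} (hφ : star φ ⬝ᵥ φ = 1) {e t : ℝ} (ht : 0 < t) (he : 1 - e ≤ sandwich ρ φ φ) :
    sandwich O φ φ - (O * ρ).trace.re ≤ t + 2 * e + e / t := by
  set S := ketbra φ with hS
  set o := sandwich O φ φ with ho
  set p := sandwich ρ φ φ with hp
  have hSe : IsEffect S := isEffect_ketbra hφ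
  have hSS : S * S = S := by simp [hS, ketbra, vecMulVec_mul_vecMulVec, hφ]
  set Q := 1 - S with hQ
  have hQQ : Q * Q = Q := by rw [hQ, sub_mul, mul_sub, mul_sub, hSS]; simp
  have hQh : Qᴴ = Q := hSe.2.isHermitian.eq
  set T := (O * ρ).trace.re with hT
  set K := (Q * O * Q * ρ).trace.re with hK
  have hSρ : (S * ρ).trace.re = p := by
    rw [trace_mul_comm, trace_mul_ketbra]; rfl
  have hK1 : K ≤ 1 - p := by
    have h := re_trace_mul_nonneg (hO.2.conjTranspose_mul_mul_same Q) hρ.1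
    rw [hQh, mul_sub Q 1 O, sub_mul, mul_one, hQQ, sub_mul, trace_sub, Complex.sub_re] at h
    have : (Q * ρ).trace.re = 1 - p := by
      rw [hQ, sub_mul, one_mul, trace_sub, Complex.sub_re, hρ.2, hSρ]; simp
    linarith
  have hT1 : T ≤ 1 := by
    have h := re_trace_mul_nonneg hO.2 hρ.1
    rw [sub_mul, one_mul, trace_sub, Complex.sub_re, hρ.2] at h
    simp only [Complex.one_re] at h
    linarith
  have hT0 : 0 ≤ T := re_trace_mul_nonneg hO.1 hρ.1
  have ho0 : 0 ≤ o := sandwich_self_nonneg hO.1 φ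
  have ho1 : o ≤ 1 := by
    have h := sandwich_self_nonneg hO.2 φ
    rw [sandwich_sub_left, sandwich_one, hφ] at h
    simp only [Complex.one_re] at h
    linarith
  have hSOS : S * O * S = ((o : ℝ) : ℂ) • S := by
    have hc : star φ ⬝ᵥ O *ᵥ φ = (o : ℂ) := by
      have h := Complex.le_def.1 (hO.1.dotProduct_mulVec_nonneg φ)
      exact Complex.ext rfl (by simpa using h.2.symm)
    rw [mul_assoc, hS]
    unfold ketbra
    rw [mul_vecMulVec, vecMulVec_mul_vecMulVec, hc]
    simp [vecMulVec_smul]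
  -- The cross terms between `φ` and its complement follow from `OQ + QO = O + QOQ - SOS`, where
  -- `SOS = oS`.
  have hx : (O * Q * ρ).trace.re + (Q * O * ρ).trace.re = T + K - o * p := by
    have e1 : O * Q * ρ + Q * O * ρ = O * ρ + Q * O * Q * ρ - S * O * S * ρ := by
      rw [hQ]; noncomm_ring
    have e2 : (S * O * S * ρ).trace.re = o * p := by
      rw [hSOS, smul_mul_assoc, trace_smul, smul_eq_mul, Complex.re_ofReal_mul, hSρ]
    rw [← Complex.add_re, ← trace_add, e1, trace_sub, trace_add, Complex.sub_re, Complex.add_re, e2]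
  -- Positivity of `(t + Q) O (t + Q)` against `ρ`; with `K ≤ 1 - p ≤ e` it bounds `o - T` after
  -- division by `t`.
  have hM : 0 ≤ t ^ 2 * T + K + t * (T + K - o * p) := by
    have hh : ((t : ℂ) • (1 : Matrix n n ℂ) + Q)ᴴ = (t : ℂ) • 1 + Q := by
      rw [conjTranspose_add, hQh, conjTranspose_smul]; simp
    have h := re_trace_mul_nonneg (hO.1.conjTranspose_mul_mul_same ((t : ℂ) • 1 + Q)) hρ.1
    have e1 : ((t : ℂ) • 1 + Q) * O * ((t : ℂ) • 1 + Q) * ρ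
        = ((t ^ 2 : ℝ) : ℂ) • (O * ρ) + Q * O * Q * ρ
          + (t : ℂ) • (O * Q * ρ + Q * O * ρ) := by
      simp only [add_mul, mul_add, smul_mul_assoc, mul_smul_comm, one_mul, mul_one, smul_add,
        smul_smul]
      push_cast
      rw [pow_two]
      abel
    rw [hh, e1, trace_add, trace_add, trace_smul, trace_smul, trace_add, Complex.add_re,
      Complex.add_re, smul_eq_mul, smul_eq_mul, Complex.re_ofReal_mul, Complex.re_ofReal_mul,
      Complex.add_re, hx] at h
    exact h
  have hp1 : p ≤ 1 := by
    have h := re_trace_mul_nonneg hSe.2 hρ.1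
    rw [sub_mul, one_mul, trace_sub, Complex.sub_re, hρ.2, hSρ] at h
    simp only [Complex.one_re] at h
    linarith
  have h2 : t * (o - T) ≤ t * (t + 2 * e + e / t) := by
    have : t * (e / t) = e := by field_simp
    have h3 : o * (1 - p) ≤ e := by nlinarith
    have h4 : t * (o * (1 - p)) ≤ t * e := mul_le_mul_of_nonneg_left h3 ht.le
    have h5 : t * K ≤ t * e := mul_le_mul_of_nonneg_left (by linarith) ht.le
    have h6 : t ^ 2 * T ≤ t ^ 2 := by nlinarith [sq_nonneg t]
    nlinarith
  exact le_of_mul_le_mul_left h2 ht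

theorem abs_sandwich_sub_trace_le {ρ O : Matrix n n ℂ} (hρ : IsDensity ρ) (hO : IsEffect O)
    {φ : n → ℂ} (hφ : star φ ⬝ᵥ φ = 1) {ε : ℝ} (hε : 0 < ε) (hε1 : ε ≤ 1 / 10)
    (h : bures ρ (ketbra φ) ≤ ε) :
    |(O * ρ).trace.re - sandwich O φ φ| ≤ 81 / 25 * ε := by
  have h0 := one_sub_le_sandwich_of_bures_le hρ.1 hφ (by linarith) h
  -- The bound `t + 2e + e/t` with `e = 2ε²` is smallest at `t = √2 ε`; `3/2` approximates `√2`. The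
  -- result `(17/6)ε + 4ε²` is below `(81/25)ε` as `ε ≤ 1/10`.
  have e1 : 3 / 2 * ε + 2 * (2 * ε ^ 2) + 2 * ε ^ 2 / (3 / 2 * ε) ≤ 81 / 25 * ε := by
    have : 2 * ε ^ 2 / (3 / 2 * ε) = 4 / 3 * ε := by field_simp; norm_num
    rw [this]
    nlinarith
  have h1 := sandwich_sub_trace_le hρ hO hφ (t := 3 / 2 * ε) (by linarith) h0
  -- The complementary effect gives the opposite inequality.
  have h2 := sandwich_sub_trace_le hρ hO.compl hφ (t := 3 / 2 * ε) (by linarith) h0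
  rw [sandwich_sub_left, sandwich_one, hφ, sub_mul, one_mul, trace_sub, Complex.sub_re, hρ.2] at h2
  rw [abs_le]
  constructor <;> linarith

end Fidelity

/-! ### Channels tensored with a reference system -/

section Channels

variable {m n : Type*}

theorem tensorId_posSemidef [Fintype m] [Fintype n] {r : Type*} [Fintype r]
    {Φ : Matrix m m ℂ →ₗ[ℂ] Matrix n n ℂ} (hΦ : IsChannel Φ)
    {X : Matrix (m × r) (m × r) ℂ} (hX : X.PosSemidef) : (tensorId Φ X).PosSemidef := by
  let e := Fintype.equivFin r
  have h := hΦ.1 (Fintype.card r) _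
    (hX.submatrix (fun p : m × Fin (Fintype.card r) => (p.1, e.symm p.2)))
  have h2 := h.submatrix (fun p : n × r => (p.1, e p.2))
  convert h2 using 1
  ext p q
  simp [tensorId]

theorem linearMap_apply_eq_sum [Fintype m] [DecidableEq m]
    (Φ : Matrix m m ℂ →ₗ[ℂ] Matrix n n ℂ) (X : Matrix m m ℂ) (k l : n) :
    Φ X k l = ∑ i, ∑ j, X i j * Φ (single i j 1) k l := by
  conv_lhs => rw [matrix_eq_sum_single X]
  simp only [map_sum, Matrix.sum_apply]
  refine Finset.sum_congr rfl fun i _ => Finset.sum_congr rfl fun j _ => ?_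
  have : single i j (X i j) = X i j • single i j (1 : ℂ) := by simp
  rw [this, map_smul, Matrix.smul_apply, smul_eq_mul]

end Channels

/-- Over `ℂ` a matrix with a nonnegative quadratic form is automatically Hermitian. -/
theorem posSemidef_of_dotProduct_nonneg {n : Type*} [Fintype n] [DecidableEq n] {M : Matrix n n ℂ}
    (h : ∀ x : n → ℂ, 0 ≤ star x ⬝ᵥ (M *ᵥ x)) : M.PosSemidef := by
  rw [← isPositive_toEuclideanLin_iff, LinearMap.isPositive_iff_complex]
  intro x
  have e : inner ℂ (M.toEuclideanLin x) x = star (star x.ofLp ⬝ᵥ (M *ᵥ x.ofLp)) := by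
    rw [star_dotProduct, star_star, EuclideanSpace.inner_eq_star_dotProduct, dotProduct_comm]
    rfl
  have h' := Complex.le_def.1 (h x.ofLp)
  rw [e]
  constructor
  · apply Complex.ext
    · simp
    · simpa using h'.2.symm
  · simpa using h'.1

/-! ### Operators acting trivially on a region, and the Heisenberg picture of recovery -/

section Regions

variable {V : Type*} [Fintype V] [DecidableEq V]

/-- The restriction of a basis state to a region. -/
def restrict (S : Finset V) (x : V → Fin 2) : Conf S := fun v => x v

/-- The operator `M` acts as the identity on the qubits in `A`. -/
def ActsTrivially (A : Finset V) (M : Matrix (V → Fin 2) (V → Fin 2) ℂ) : Prop :=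
  (∀ x y, M x y ≠ 0 → ∀ v ∈ A, x v = y v) ∧
    ∀ x y x' y' : V → Fin 2, (∀ v ∉ A, x v = x' v) → (∀ v ∉ A, y v = y' v) →
      (∀ v ∈ A, x v = y v) → (∀ v ∈ A, x' v = y' v) → M x y = M x' y'

theorem actsTrivially_empty (M : Matrix (V → Fin 2) (V → Fin 2) ℂ) : ActsTrivially ∅ M := by
  refine ⟨by simp, fun x y x' y' hx hy _ _ => ?_⟩
  rw [show x = x' from funext fun v => hx v (by simp), show y = y' from funext fun v => hy v (by simp)]

theorem ActsTrivially.union {A A' : Finset V} {M : Matrix (V → Fin 2) (V → Fin 2) ℂ}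
    (h : ActsTrivially A M) (h' : ActsTrivially A' M) : ActsTrivially (A ∪ A') M := by
  constructor
  · intro x y hxy v hv
    rcases Finset.mem_union.1 hv with hv | hv
    · exact h.1 x y hxy v hv
    · exact h'.1 x y hxy v hv
  · intro x y x' y' hx hy hxy hxy'
    simp only [Finset.mem_union, not_or, and_imp] at hx hy hxy hxy'
    -- Pass through the configurations changed on `A` only, then change the rest of `A'`.
    rw [h.2 x y (fun v => if v ∈ A then x' v else x v) (fun v => if v ∈ A then y' v else y v)]
    · refine h'.2 _ _ _ _ ?_ ?_ ?_ ?_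
      all_goals intro v hv; grind
    all_goals intro v hv; grind

/-- In either product only one intermediate configuration contributes: each factor must preserve its
own trivial region. The two surviving terms have equal factors in opposite order. -/
theorem ActsTrivially.commute_of_compl {A : Finset V} {M N : Matrix (V → Fin 2) (V → Fin 2) ℂ}
    (hM : ActsTrivially A M) (hN : ActsTrivially Aᶜ N) : Commute M N := by
  have key : ∀ {A : Finset V} {M N : Matrix (V → Fin 2) (V → Fin 2) ℂ}, ActsTrivially A M →
      ActsTrivially Aᶜ N → ∀ x y, (M * N) x y =
        M x (fun v => if v ∈ A then x v else y v) * N (fun v => if v ∈ A then x v else y v) y := by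
    intro A M N hM hN x y
    rw [mul_apply]
    refine Finset.sum_eq_single _ (fun z _ hz => ?_) (by simp)
    by_contra h
    refine hz (funext fun v => ?_)
    by_cases hv : v ∈ A
    · simp [hv, hM.1 x z (left_ne_zero_of_mul h) v hv]
    · simp [hv, hN.1 z y (right_ne_zero_of_mul h) v (Finset.mem_compl.2 hv)]
  change M * N = N * M
  ext x y
  rw [key hM hN, key hN (by rwa [compl_compl]), mul_comm]
  congr 1
  · refine hN.2 _ _ _ _ ?_ ?_ ?_ ?_
    all_goals intro v hv; grind [Finset.mem_compl]
  · refine hM.2 _ _ _ _ ?_ ?_ ?_ ?_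
    all_goals intro v hv; grind [Finset.mem_compl]

/-- The adjoint (Heisenberg picture) of erasing `A` and then applying `Φ`, on operators of all
qubits. -/
noncomputable def heisenberg (A N : Finset V)
    (Φ : Matrix (Conf (N \ A)) (Conf (N \ A)) ℂ →ₗ[ℂ] Matrix (Conf N) (Conf N) ℂ)
    (O : Matrix (V → Fin 2) (V → Fin 2) ℂ) : Matrix (V → Fin 2) (V → Fin 2) ℂ :=
  Matrix.of fun x y =>
    if restrict A x = restrict A y then
      ∑ k : Conf N, ∑ l : Conf N,
        O (glue₂ N k (restrict Nᶜ x)) (glue₂ N l (restrict Nᶜ y)) *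
          Φ (single (restrict (N \ A) y) (restrict (N \ A) x) 1) l k
    else 0

variable {A N : Finset V}
  {Φ : Matrix (Conf (N \ A)) (Conf (N \ A)) ℂ →ₗ[ℂ] Matrix (Conf N) (Conf N) ℂ}

theorem actsTrivially_heisenberg (hAN : A ⊆ N) (O : Matrix (V → Fin 2) (V → Fin 2) ℂ) :
    ActsTrivially A (heisenberg A N Φ O) := by
  constructor
  · intro x y h v hv
    by_contra hne
    refine h (if_neg fun he => hne (congrFun he ⟨v, hv⟩))
  · intro x y x' y' hx hy hxy hxy'
    have e1 : restrict A x = restrict A y := funext fun v => hxy v v.2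
    have e2 : restrict A x' = restrict A y' := funext fun v => hxy' v v.2
    have c : ∀ z z' : V → Fin 2, (∀ v ∉ A, z v = z' v) →
        restrict Nᶜ z = restrict Nᶜ z' ∧ restrict (N \ A) z = restrict (N \ A) z' := fun z z' h =>
      ⟨funext fun v => h v fun hv => Finset.mem_compl.1 v.2 (hAN hv),
        funext fun v => h v (Finset.mem_sdiff.1 v.2).2⟩
    simp only [heisenberg, of_apply, if_pos e1, if_pos e2, (c x x' hx).1, (c x x' hx).2,
      (c y y' hy).1, (c y y' hy).2]

/-- Recovery acts within `N`, so triviality already obtained away from `N` survives. This is what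
allows successive cleaning. -/
theorem ActsTrivially.heisenberg {A' : Finset V} (hAN : A ⊆ N) (h : Disjoint A' N)
    {O : Matrix (V → Fin 2) (V → Fin 2) ℂ} (hO : ActsTrivially A' O) :
    ActsTrivially A' (heisenberg A N Φ O) := by
  have hg : ∀ (k : Conf N) (x : V → Fin 2) (v : V), v ∈ A' →
      glue₂ N k (restrict Nᶜ x) v = x v := fun k x v hv => by
    simp [glue₂, restrict, Finset.disjoint_left.1 h hv]
  have hg' : ∀ (k : Conf N) (x x' : V → Fin 2) (v : V), x v = x' v →
      glue₂ N k (restrict Nᶜ x) v = glue₂ N k (restrict Nᶜ x') v := fun k x x' v hv => by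
    simp [glue₂, restrict, hv]
  constructor
  · intro x y hxy v hv
    by_contra hne
    refine hxy ?_
    have hz : ∀ k l : Conf N,
        O (glue₂ N k (restrict Nᶜ x)) (glue₂ N l (restrict Nᶜ y)) = 0 := by
      intro k l
      by_contra h0
      have := hO.1 _ _ h0 v hv
      rw [hg _ _ _ hv, hg _ _ _ hv] at this
      exact hne this
    simp [LocalAQEC.heisenberg, hz]
  · intro x y x' y' hx hy hxy hxy'
    have c : ∀ z z' : V → Fin 2, (∀ v ∉ A', z v = z' v) → ∀ S ⊆ N,
        restrict S z = restrict S z' := fun z z' hz S hS =>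
      funext fun v => hz v fun hv => Finset.disjoint_left.1 h hv (hS v.2)
    have hS : N \ A ⊆ N := Finset.sdiff_subset
    simp only [LocalAQEC.heisenberg, of_apply, c x x' hx _ hAN, c y y' hy _ hAN, c x x' hx _ hS,
      c y y' hy _ hS]
    refine if_congr Iff.rfl (Finset.sum_congr rfl fun k _ => Finset.sum_congr rfl fun l _ => ?_) rfl
    congr 1
    refine hO.2 _ _ _ _ (fun v hv => hg' _ _ _ _ (hx v hv)) (fun v hv => hg' _ _ _ _ (hy v hv))
      (fun v hv => ?_) fun v hv => ?_
    · rw [hg _ _ _ hv, hg _ _ _ hv, hxy v hv]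
    · rw [hg _ _ _ hv, hg _ _ _ hv, hxy' v hv]

theorem glue₂_restrict (N : Finset V) (x : V → Fin 2) :
    glue₂ N (restrict N x) (restrict Nᶜ x) = x := by
  funext v
  by_cases h : v ∈ N <;> simp [glue₂, restrict, h]

theorem restrict_glue₂ (N : Finset V) (k : Conf N) (c : Conf Nᶜ) :
    restrict N (glue₂ N k c) = k ∧ restrict Nᶜ (glue₂ N k c) = c := by
  constructor <;> funext v
  · simp [glue₂, restrict]
  · have := Finset.mem_compl.1 v.2
    simp [glue₂, restrict, this]

theorem restrict_glue₃ (hAN : A ⊆ N) (a : Conf A) (b : Conf (N \ A)) (c : Conf Nᶜ) :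
    restrict A (glue₃ A N a b c) = a ∧ restrict (N \ A) (glue₃ A N a b c) = b ∧
      restrict Nᶜ (glue₃ A N a b c) = c := by
  refine ⟨funext fun v => ?_, funext fun v => ?_, funext fun v => ?_⟩
  · simp [glue₃, restrict, hAN v.2]
  · have := Finset.mem_sdiff.1 v.2
    simp [glue₃, restrict, this]
  · have := Finset.mem_compl.1 v.2
    simp [glue₃, restrict, this]

theorem glue₃_restrict (x : V → Fin 2) :
    glue₃ A N (restrict A x) (restrict (N \ A) x) (restrict Nᶜ x) = x := by
  funext v
  by_cases h : v ∈ N <;> by_cases h' : v ∈ A <;> simp [glue₃, restrict, h, h']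

/-- Basis states of all qubits and of a trivial reference system, cut along `N`. -/
def glueEquiv₂ (N : Finset V) : Conf N × (Conf Nᶜ × Fin 1) ≃ (V → Fin 2) where
  toFun p := glue₂ N p.1 p.2.1
  invFun x := (restrict N x, restrict Nᶜ x, 0)
  left_inv p := Prod.ext (restrict_glue₂ N p.1 p.2.1).1
    (Prod.ext (restrict_glue₂ N p.1 p.2.1).2 (Subsingleton.elim _ _))
  right_inv x := glue₂_restrict N x

/-- Basis states of all qubits, cut along `A ⊆ N`. -/
def glueEquiv₃ (hAN : A ⊆ N) : Conf A × Conf (N \ A) × Conf Nᶜ ≃ (V → Fin 2) where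
  toFun p := glue₃ A N p.1 p.2.1 p.2.2
  invFun x := (restrict A x, restrict (N \ A) x, restrict Nᶜ x)
  left_inv p := by
    obtain ⟨h1, h2, h3⟩ := restrict_glue₃ hAN p.1 p.2.1 p.2.2
    simp [h1, h2, h3]
  right_inv x := glue₃_restrict x

/-- An operator on the qubits, viewed as an operator with a trivial reference system. -/
def withTrivial (X : Matrix (V → Fin 2) (V → Fin 2) ℂ) :
    Matrix ((V → Fin 2) × Fin 1) ((V → Fin 2) × Fin 1) ℂ :=
  X.submatrix Prod.fst Prod.fst

theorem sum_reorder {α β γ κ : Type*} [Fintype α] [Fintype β] [Fintype γ] [Fintype κ]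
    (F : α → β → γ → β → γ → κ → κ → ℂ) :
    ∑ a, ∑ j, ∑ c, ∑ i, ∑ c', ∑ k, ∑ l, F a j c i c' k l =
      ∑ k, ∑ c, ∑ l, ∑ c', ∑ i, ∑ j, ∑ a, F a j c i c' k l := by
  let e : (((((α × β) × γ) × β) × γ) × κ) × κ ≃ (((((κ × γ) × κ) × γ) × β) × β) × α :=
    { toFun := fun ⟨⟨⟨⟨⟨⟨a, j⟩, c⟩, i⟩, c'⟩, k⟩, l⟩ => ⟨⟨⟨⟨⟨⟨k, c⟩, l⟩, c'⟩, i⟩, j⟩, a⟩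
      invFun := fun ⟨⟨⟨⟨⟨⟨k, c⟩, l⟩, c'⟩, i⟩, j⟩, a⟩ => ⟨⟨⟨⟨⟨⟨a, j⟩, c⟩, i⟩, c'⟩, k⟩, l⟩
      left_inv := fun _ => rfl
      right_inv := fun _ => rfl }
  have h := Fintype.sum_equiv e
    (fun p => F p.1.1.1.1.1.1 p.1.1.1.1.1.2 p.1.1.1.1.2 p.1.1.1.2 p.1.1.2 p.1.2 p.2)
    (fun p => F p.2 p.1.2 p.1.1.1.1.1.2 p.1.1.2 p.1.1.1.2 p.1.1.1.1.1.1 p.1.1.1.1.2) fun _ => rfl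
  simpa only [Fintype.sum_prod_type] using h

/-- The duality that justifies the definition of `heisenberg`: both sides expand into the same
sevenfold sum. Positivity and the comparison of expectations are transferred from the channel
through it. -/
theorem trace_heisenberg_mul (hAN : A ⊆ N) (O X : Matrix (V → Fin 2) (V → Fin 2) ℂ) :
    (heisenberg A N Φ O * X).trace =
      (split N (withTrivial O) * tensorId Φ (erase A N (withTrivial X))).trace := by
  have hl : (heisenberg A N Φ O * X).trace = ∑ a : Conf A, ∑ j : Conf (N \ A), ∑ c : Conf Nᶜ,
      ∑ i : Conf (N \ A), ∑ c' : Conf Nᶜ, ∑ k : Conf N, ∑ l : Conf N,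
        O (glue₂ N k c) (glue₂ N l c') * Φ (single i j 1) l k *
          X (glue₃ A N a i c') (glue₃ A N a j c) := by
    simp only [trace, diag_apply, mul_apply]
    rw [← (glueEquiv₃ hAN).sum_comp (fun x => ∑ y, heisenberg A N Φ O x y * X y x)]
    simp only [fun x => ((glueEquiv₃ hAN).sum_comp
      (fun y => heisenberg A N Φ O x y * X y x)).symm]
    simp only [glueEquiv₃, Equiv.coe_fn_mk, heisenberg, of_apply, (restrict_glue₃ hAN _ _ _).1,
      (restrict_glue₃ hAN _ _ _).2.1, (restrict_glue₃ hAN _ _ _).2.2, Fintype.sum_prod_type,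
      ite_mul, zero_mul]
    refine Finset.sum_congr rfl fun a _ => Finset.sum_congr rfl fun j _ =>
      Finset.sum_congr rfl fun c _ => ?_
    rw [Finset.sum_eq_single a (fun a' _ h => by simp [Ne.symm h]) (by simp)]
    simp only [if_true, Finset.sum_mul]
  rw [hl, sum_reorder]
  simp only [trace, diag_apply, mul_apply, Fintype.sum_prod_type, Finset.univ_unique,
    Finset.sum_singleton]
  refine Finset.sum_congr rfl fun k _ => Finset.sum_congr rfl fun c _ =>
    Finset.sum_congr rfl fun l _ => Finset.sum_congr rfl fun c' _ => ?_
  simp only [tensorId, of_apply]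
  rw [linearMap_apply_eq_sum, Finset.mul_sum]
  refine Finset.sum_congr rfl fun i _ => ?_
  rw [Finset.mul_sum]
  refine Finset.sum_congr rfl fun j _ => ?_
  simp only [erase, of_apply, Finset.sum_mul, Finset.mul_sum, split, withTrivial, submatrix_apply]
  refine Finset.sum_congr rfl fun a _ => ?_
  ring

theorem split_withTrivial (O : Matrix (V → Fin 2) (V → Fin 2) ℂ) :
    split N (withTrivial O) = O.submatrix (glueEquiv₂ N) (glueEquiv₂ N) := rfl

theorem withTrivial_ketbra (ψ : (V → Fin 2) → ℂ) :
    withTrivial (ketbra ψ) = ketbra fun p : (V → Fin 2) × Fin 1 => ψ p.1 := rfl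

theorem split_withTrivial_ketbra (ψ : (V → Fin 2) → ℂ) :
    split N (withTrivial (ketbra ψ)) = ketbra (ψ ∘ glueEquiv₂ N) := rfl

theorem isEffect_split_withTrivial {O : Matrix (V → Fin 2) (V → Fin 2) ℂ} (hO : IsEffect O) :
    IsEffect (split N (withTrivial O)) := by
  refine ⟨hO.1.submatrix _, ?_⟩
  have h := hO.2.submatrix (glueEquiv₂ N)
  rwa [submatrix_sub, Pi.sub_apply, Pi.sub_apply, submatrix_one_equiv] at h

theorem sandwich_split_withTrivial (O : Matrix (V → Fin 2) (V → Fin 2) ℂ)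
    (ψ : (V → Fin 2) → ℂ) :
    sandwich (split N (withTrivial O)) (ψ ∘ glueEquiv₂ N) (ψ ∘ glueEquiv₂ N) =
      sandwich O ψ ψ := by
  unfold sandwich
  rw [split_withTrivial, submatrix_mulVec_equiv]
  have : star (ψ ∘ glueEquiv₂ N) = star ψ ∘ glueEquiv₂ N := rfl
  rw [this, comp_equiv_dotProduct_comp_equiv, Function.comp_assoc, Equiv.self_comp_symm,
    Function.comp_id]

theorem star_dotProduct_comp_glueEquiv₂ (ψ : (V → Fin 2) → ℂ) :
    star (ψ ∘ glueEquiv₂ N) ⬝ᵥ (ψ ∘ glueEquiv₂ N) = star ψ ⬝ᵥ ψ :=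
  comp_equiv_dotProduct_comp_equiv (star ψ) ψ (glueEquiv₂ N)

theorem erase_posSemidef {r : ℕ} {X : Matrix ((V → Fin 2) × Fin r) ((V → Fin 2) × Fin r) ℂ}
    (hX : X.PosSemidef) : (erase A N X).PosSemidef := by
  have : erase A N X = ∑ a : Conf A, X.submatrix
      (fun p : Conf (N \ A) × (Conf Nᶜ × Fin r) => (glue₃ A N a p.1 p.2.1, p.2.2))
      (fun p => (glue₃ A N a p.1 p.2.1, p.2.2)) := by
    ext p q
    simp [erase, Matrix.sum_apply]
  rw [this]
  exact posSemidef_sum _ fun a _ => hX.submatrix _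

theorem heisenberg_posSemidef (hΦ : IsChannel Φ) (hAN : A ⊆ N)
    {O : Matrix (V → Fin 2) (V → Fin 2) ℂ} (hO : O.PosSemidef) :
    (heisenberg A N Φ O).PosSemidef := by
  have h : ∀ x : (V → Fin 2) → ℂ, 0 ≤ star x ⬝ᵥ (heisenberg A N Φ O *ᵥ x) := fun x => by
    rw [← trace_mul_ketbra, trace_heisenberg_mul hAN]
    exact trace_mul_nonneg (hO.submatrix _) (tensorId_posSemidef hΦ
      (erase_posSemidef ((ketbra_posSemidef x).submatrix _)))
  exact posSemidef_of_dotProduct_nonneg h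

theorem heisenberg_sub (O O' : Matrix (V → Fin 2) (V → Fin 2) ℂ) :
    heisenberg A N Φ (O - O') = heisenberg A N Φ O - heisenberg A N Φ O' := by
  ext x y
  by_cases h : restrict A x = restrict A y
  · simp [heisenberg, h, sub_mul]
  · simp [heisenberg, h]

/-- Unitality is dual to trace preservation of `Φ`; it is needed to keep the upper bound `1` on
effects. -/
theorem heisenberg_one (hΦ : IsChannel Φ) : heisenberg A N Φ 1 = 1 := by
  ext x y
  by_cases hA : restrict A x = restrict A y
  · by_cases hC : restrict Nᶜ x = restrict Nᶜ y
    · have hinj : ∀ k l : Conf N,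
          glue₂ N k (restrict Nᶜ y) = glue₂ N l (restrict Nᶜ y) ↔ k = l := fun k l => by
        refine ⟨fun h => ?_, fun h => by rw [h]⟩
        rw [← (restrict_glue₂ N k (restrict Nᶜ y)).1, h, (restrict_glue₂ N l _).1]
      have hs : heisenberg A N Φ 1 x y =
          (Φ (single (restrict (N \ A) y) (restrict (N \ A) x) 1)).trace := by
        simp [heisenberg, one_apply, hA, hC, hinj, trace]
      rw [hs, hΦ.2]
      by_cases hB : restrict (N \ A) x = restrict (N \ A) y
      · have hxy : x = y := by
          rw [← glue₃_restrict (A := A) (N := N) x, hA, hB, hC, glue₃_restrict]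
        rw [hxy, one_apply_eq, trace_single_eq_same]
      · rw [one_apply_ne (fun h => hB (by rw [h])), trace_single_eq_of_ne _ _ _ (Ne.symm hB)]
    · have hne : ∀ k l : Conf N, glue₂ N k (restrict Nᶜ x) ≠ glue₂ N l (restrict Nᶜ y) :=
        fun k l h => hC (by
          rw [← (restrict_glue₂ N k (restrict Nᶜ x)).2, h, (restrict_glue₂ N l _).2])
      rw [one_apply_ne (fun h => hC (by rw [h]))]
      simp [heisenberg, one_apply, hne]
  · rw [one_apply_ne (fun h => hA (by rw [h]))]
    simp [heisenberg, hA]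

theorem IsEffect.heisenberg (hΦ : IsChannel Φ) (hAN : A ⊆ N)
    {O : Matrix (V → Fin 2) (V → Fin 2) ℂ} (hO : IsEffect O) :
    IsEffect (heisenberg A N Φ O) := by
  refine ⟨heisenberg_posSemidef hΦ hAN hO.1, ?_⟩
  have := heisenberg_posSemidef hΦ hAN hO.2
  rwa [heisenberg_sub, heisenberg_one hΦ] at this

/-- If a region is recoverable, then effects can be deformed away from it on the code. -/
theorem IsRecoverable.exists_heisenberg {C : Code V} {δ : ℝ} (hAN : A ⊆ N)
    (h : IsRecoverable C δ A N) (hδ : 0 < δ) (hδ' : δ ≤ 1 / 10) :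
    ∃ Φ : Matrix (Conf (N \ A)) (Conf (N \ A)) ℂ →ₗ[ℂ] Matrix (Conf N) (Conf N) ℂ, IsChannel Φ ∧
      ∀ O, IsEffect O → ∀ ψ ∈ C, star ψ ⬝ᵥ ψ = 1 →
        |sandwich (LocalAQEC.heisenberg A N Φ O) ψ ψ - sandwich O ψ ψ| ≤ 81 / 25 * δ := by
  obtain ⟨Φ, hΦ, hr⟩ := h
  refine ⟨Φ, hΦ, fun O hO ψ hψ hn => ?_⟩
  have htr : (ketbra ψ).trace = 1 := by rw [ketbra, trace_vecMulVec, dotProduct_comm, hn]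
  have hcode : IsCodeState C (ketbra ψ) := by
    refine ⟨⟨ketbra_posSemidef ψ, htr⟩, fun v => ?_⟩
    rw [ketbra, vecMulVec_mulVec]
    rw [op_smul_eq_smul]
    exact C.smul_mem _ hψ
  -- A pure code state is its own purification with a one-dimensional reference system.
  have hb := hr _ hcode 1 (fun p => ψ p.1) fun x y => by simp [ketbra, vecMulVec_apply]
  rw [← withTrivial_ketbra, split_withTrivial_ketbra] at hb
  have hd : IsDensity (tensorId Φ (erase A N (withTrivial (ketbra ψ)))) := by
    refine ⟨tensorId_posSemidef hΦ (erase_posSemidef ((ketbra_posSemidef ψ).submatrix _)), ?_⟩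
    have h := trace_heisenberg_mul (Φ := Φ) hAN 1 (ketbra ψ)
    rwa [heisenberg_one hΦ, one_mul, htr, split_withTrivial, submatrix_one_equiv, one_mul,
      eq_comm] at h
  have h := abs_sandwich_sub_trace_le hd (isEffect_split_withTrivial (N := N) hO)
    (by rw [star_dotProduct_comp_glueEquiv₂, hn]) hδ hδ' hb
  rwa [← trace_heisenberg_mul hAN, trace_mul_ketbra, sandwich_split_withTrivial] at h

end Regions

/-! ### Cleaning effects off regions -/

section Cleaning

variable {V : Type*} [Fintype V] [DecidableEq V]

theorem ActsTrivially.mono {A A' : Finset V} (hA : A' ⊆ A)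
    {M : Matrix (V → Fin 2) (V → Fin 2) ℂ} (h : ActsTrivially A M) : ActsTrivially A' M := by
  refine ⟨fun x y hxy v hv => h.1 x y hxy v (hA hv), fun x y x' y' hx hy hxy hxy' => ?_⟩
  by_cases hA' : ∀ v ∈ A, x v = y v
  · refine h.2 x y x' y' (fun v hv => hx v fun h => hv (hA h)) (fun v hv => hy v fun h => hv (hA h))
      hA' fun v hv => ?_
    by_cases hv' : v ∈ A'
    · exact hxy' v hv'
    · rw [← hx v hv', ← hy v hv', hA' v hv]
  · push Not at hA'
    obtain ⟨v, hv, hne⟩ := hA'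
    have hv' : v ∉ A' := fun h => hne (hxy v h)
    have h1 : M x y = 0 := by
      by_contra h0
      exact hne (h.1 x y h0 v hv)
    have h2 : M x' y' = 0 := by
      by_contra h0
      refine hne ?_
      rw [hx v hv', hy v hv', h.1 x' y' h0 v hv]
    rw [h1, h2]

/-- Every effect agrees, up to `ε` on the code, with an effect that acts trivially on `A`. -/
def IsCleanable (C : Code V) (A : Finset V) (ε : ℝ) : Prop :=
  ∀ O, IsEffect O → ∃ Q, IsEffect Q ∧ ActsTrivially A Q ∧
    ∀ ψ ∈ C, star ψ ⬝ᵥ ψ = 1 → |sandwich Q ψ ψ - sandwich O ψ ψ| ≤ ε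

/-- Induction on `J`: each new deformation clears its own region, keeps the earlier ones clear
because they avoid its neighbourhood, and adds one error. -/
theorem isCleanable_biUnion {ι : Type*} [DecidableEq ι] {C : Code V} {A N : ι → Finset V}
    {δ : ℝ} (hδ : 0 < δ) (hδ' : δ ≤ 1 / 10) (J : Finset ι) (hAN : ∀ j ∈ J, A j ⊆ N j)
    (hr : ∀ j ∈ J, IsRecoverable C δ (A j) (N j))
    (hd : ∀ j ∈ J, ∀ k ∈ J, k ≠ j → Disjoint (A k) (N j)) :
    IsCleanable C (J.biUnion A) (J.card * (81 / 25 * δ)) := by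
  intro O hO
  induction J using Finset.induction_on with
  | empty => exact ⟨O, hO, by simpa using actsTrivially_empty O, by simp⟩
  | insert j J hj ih =>
    simp only [Finset.forall_mem_insert] at hAN hr hd
    obtain ⟨Q, hQ, hQt, hQe⟩ := ih hAN.2 hr.2 fun i hi k hk => (hd.2 i hi).2 k hk
    obtain ⟨Φ, hΦ, hΦe⟩ := hr.1.exists_heisenberg hAN.1 hδ hδ'
    refine ⟨heisenberg (A j) (N j) Φ Q, hQ.heisenberg hΦ hAN.1, ?_, fun ψ hψ hn => ?_⟩
    · rw [Finset.biUnion_insert]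
      refine (actsTrivially_heisenberg hAN.1 Q).union (hQt.heisenberg hAN.1 ?_)
      rw [Finset.disjoint_biUnion_left]
      exact fun k hk => hd.1.2 k hk fun h => hj (h ▸ hk)
    · have h1 := hΦe Q hQ ψ hψ hn
      have h2 := hQe ψ hψ hn
      rw [Finset.card_insert_of_notMem hj]
      push_cast
      rw [abs_le] at *
      constructor <;> linarith

theorem exists_orthonormal_pair {n : Type*} [Fintype n] (C : Submodule ℂ (n → ℂ))
    (hC : 1 < Module.finrank ℂ C) :
    ∃ a ∈ C, ∃ b ∈ C, star a ⬝ᵥ a = 1 ∧ star b ⬝ᵥ b = 1 ∧ star a ⬝ᵥ b = 0 := by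
  let e := (WithLp.linearEquiv 2 ℂ (n → ℂ)).symm
  let C' : Submodule ℂ (EuclideanSpace ℂ n) := C.map e.toLinearMap
  have hf : Module.finrank ℂ C' = Module.finrank ℂ C := LinearEquiv.finrank_map_eq e C
  let u := stdOrthonormalBasis ℂ C'
  have hmem : ∀ x : C', (x : EuclideanSpace ℂ n).ofLp ∈ C := by
    rintro ⟨_, y, hy, rfl⟩
    exact hy
  have hin : ∀ x y : C', star (x : EuclideanSpace ℂ n).ofLp ⬝ᵥ (y : EuclideanSpace ℂ n).ofLp
      = inner ℂ x y := fun x y => by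
    rw [Submodule.coe_inner, EuclideanSpace.inner_eq_star_dotProduct, dotProduct_comm]
  let i : Fin (Module.finrank ℂ C') := ⟨0, by omega⟩
  let j : Fin (Module.finrank ℂ C') := ⟨1, by omega⟩
  have ho := orthonormal_iff_ite.1 u.orthonormal
  refine ⟨_, hmem (u i), _, hmem (u j), ?_, ?_, ?_⟩
  · rw [hin, ho, if_pos rfl]
  · rw [hin, ho, if_pos rfl]
  · rw [hin, ho, if_neg (by simp [i, j])]

/-- Two regions that cover all qubits cannot both be cleaned well. -/
theorem cleaning_tradeoff {C : Code V} (hC : 1 < Module.finrank ℂ C) {A B : Finset V}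
    (hAB : A ∪ B = Finset.univ) {ε₁ ε₂ : ℝ} (hA : IsCleanable C A ε₁)
    (hB : IsCleanable C B ε₂) : 2 ≤ 9 * ε₁ + 6 * ε₂ := by
  obtain ⟨a, haC, b, hbC, ha, hb, hab⟩ := exists_orthonormal_pair C hC
  have hba : star b ⬝ᵥ a = 0 := by
    have : star (star a ⬝ᵥ b) = star b ⬝ᵥ a := by rw [star_dotProduct, star_star]
    rw [← this, hab, star_zero]
  obtain ⟨s, hs⟩ : ∃ s : ℝ, s * s = 1 / 2 := ⟨Real.sqrt (1 / 2), Real.mul_self_sqrt (by norm_num)⟩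
  have hs' : (s : ℂ) * s = 1 / 2 := by rw [← Complex.ofReal_mul, hs]; norm_num
  set u := (s : ℂ) • (a + b) with hu
  set w := (s : ℂ) • (a - b) with hw
  have huC : u ∈ C := C.smul_mem _ (C.add_mem haC hbC)
  have hwC : w ∈ C := C.smul_mem _ (C.sub_mem haC hbC)
  have huu : star u ⬝ᵥ u = 1 := by
    simp only [hu, star_smul, star_add, smul_dotProduct, dotProduct_smul, add_dotProduct,
      dotProduct_add, ha, hb, hab, hba, smul_eq_mul, Complex.star_def, Complex.conj_ofReal]
    linear_combination 2 * hs'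
  have hww : star w ⬝ᵥ w = 1 := by
    simp only [hw, star_smul, star_sub, smul_dotProduct, dotProduct_smul, sub_dotProduct,
      dotProduct_sub, ha, hb, hab, hba, smul_eq_mul, Complex.star_def, Complex.conj_ofReal]
    linear_combination 2 * hs'
  have huw : star u ⬝ᵥ w = 0 := by
    simp only [hu, hw, star_smul, star_add, smul_dotProduct, dotProduct_smul, add_dotProduct,
      dotProduct_sub, ha, hb, hab, hba, smul_eq_mul, Complex.star_def, Complex.conj_ofReal]
    norm_num
  -- `Q` inherits the task of telling `a` from `b`, and `P` that of telling `u` from `w`.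
  obtain ⟨Q, hQ, hQt, hQe⟩ := hA _ (isEffect_ketbra ha)
  obtain ⟨P, hP, hPt, hPe⟩ := hB _ (isEffect_ketbra huu)
  have hsub : Aᶜ ⊆ B := fun v hv => by
    have := Finset.mem_union.1 (hAB ▸ Finset.mem_univ v)
    exact this.resolve_left (Finset.mem_compl.1 hv)
  have hcomm : Commute P Q := (hQt.commute_of_compl (hPt.mono hsub)).symm
  have q1 := hQe a haC ha
  have q2 := hQe b hbC hb
  have p1 := hPe u huC huu
  have p2 := hPe w hwC hww
  rw [sandwich_ketbra, abs_le] at q1 q2 p1 p2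
  rw [ha, map_one] at q1
  rw [hab, map_zero] at q2
  rw [huu, map_one] at p1
  rw [huw, map_zero] at p2
  -- Polarization turns the distinguishability of `u` and `w` into a large off-diagonal element of
  -- `P`.
  have hpol : sandwich P u u - sandwich P w w = 2 * sandwich P a b := by
    have e : a - b = a + ((-1 : ℝ) : ℂ) • b := by push_cast; module
    rw [hu, hw, e]
    simp only [sandwich_smul_mid, sandwich_smul_right, sandwich_add_mid, sandwich_add_right,
      sandwich_comm hP.1.isHermitian a b]
    linear_combination 4 * sandwich P a b * hs
  exact commuting_effects_tradeoff hP hQ hcomm ha hb hab (by linarith) (by linarith) (by linarith)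

end Cleaning

/-! ### Slabs of the lattice: size and separation -/

section Slabs

variable {D L : ℕ}

theorem subset_nbhd (periodic : Fin D → Bool) {ℓ : ℝ} (hℓ : 0 ≤ ℓ) (A : Finset (Site D L)) :
    A ⊆ nbhd periodic ℓ A := by
  intro x hx
  refine Finset.mem_filter.2 ⟨Finset.mem_univ _, x, hx, ?_⟩
  simpa [siteDist, coordDist, Nat.dist_self] using hℓ

theorem coordDist_le_siteDist (periodic : Fin D → Bool) (x y : Site D L) (i : Fin D) :
    (coordDist (periodic i) (x i) (y i) : ℝ) ≤ siteDist periodic x y :=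
  Real.le_sqrt_of_sq_le (Finset.single_le_sum
    (f := fun i => (coordDist (periodic i) (x i) (y i) : ℝ) ^ 2)
    (fun _ _ => sq_nonneg _) (Finset.mem_univ i))

theorem coordDist_comm (b : Bool) (x y : Fin L) : coordDist b x y = coordDist b y x := by
  simp [coordDist, Nat.dist_comm]

/-- The sites whose coordinate in direction `i` lies in the `j`-th of `m` consecutive intervals. -/
def slab (i : Fin D) (m j : ℕ) : Finset (Site D L) :=
  Finset.univ.filter fun x => m * (x i : ℕ) / L = j

theorem card_interval_le {m : ℕ} (hm : 0 < m) (j : ℕ) :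
    (Finset.univ.filter fun x : Fin L => m * (x : ℕ) / L = j).card ≤ L / m + 1 := by
  set S := Finset.univ.filter fun x : Fin L => m * (x : ℕ) / L = j with hS
  rcases S.eq_empty_or_nonempty with h | h
  · simp [h]
  obtain ⟨a, ha, hmin⟩ := S.exists_min_image (fun x => (x : ℕ)) h
  have hL : 0 < L := a.pos
  have hmap : S.map Fin.valEmbedding ⊆ Finset.Ico (a : ℕ) (a + (L / m + 1)) := by
    intro y hy
    obtain ⟨x, hx, rfl⟩ := Finset.mem_map.1 hy
    have h1 := hmin x hx
    have ha' := (Nat.div_eq_iff hL).1 (Finset.mem_filter.1 ha).2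
    have hx' := (Nat.div_eq_iff hL).1 (Finset.mem_filter.1 hx).2
    refine Finset.mem_Ico.2 ⟨h1, ?_⟩
    -- Two points of one interval differ by less than `L / m`; counting both ends gives the `+ 1`.
    have h2 : m * ((x : ℕ) - a) < L := by
      rw [Nat.mul_sub]
      omega
    have h3 : (x : ℕ) - a ≤ L / m := (Nat.le_div_iff_mul_le hm).2 (by rw [mul_comm]; exact h2.le)
    simp only [Fin.valEmbedding_apply]
    omega
  simpa using Finset.card_le_card hmap

theorem card_slab_le (i : Fin D) {m : ℕ} (hm : 0 < m) (j : ℕ) :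
    (slab (L := L) i m j).card ≤ (L / m + 1) * L ^ (D - 1) := by
  have h : slab (L := L) i m j = Fintype.piFinset (Function.update (fun _ => Finset.univ) i
      (Finset.univ.filter fun x : Fin L => m * (x : ℕ) / L = j)) := by
    ext x
    simp only [slab, Finset.mem_filter, Finset.mem_univ, true_and, Fintype.mem_piFinset]
    constructor
    · intro h k
      rcases eq_or_ne k i with rfl | hk
      · simpa using h
      · simp [hk]
    · intro h
      simpa using h i
  rw [h, Fintype.card_piFinset, ← Finset.mul_prod_erase _ _ (Finset.mem_univ i)]
  refine Nat.mul_le_mul (by simpa using card_interval_le hm j) (le_of_eq ?_)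
  rw [Finset.prod_congr rfl (g := fun _ => L)
    fun k hk => by simp [(Finset.mem_erase.1 hk).1]]
  simp

/-- A whole interval, of length `L / m ≥ ℓ`, separates the points on either way round the cycle:
`hpq` gives the direct way and `hqp` the way through the boundary. -/
theorem lt_coordDist {ℓ : ℝ} {m p q : ℕ} (hm : 0 < m) (hL : (m : ℝ) * ℓ ≤ L) (b : Bool)
    {x y : Fin L} (hx : m * (x : ℕ) / L = p) (hy : m * (y : ℕ) / L = q) (hpq : p + 2 ≤ q)
    (hqp : q + 2 ≤ p + m) : ℓ < coordDist b x y := by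
  have hL0 : 0 < L := x.pos
  rw [Nat.div_eq_iff hL0] at hx hy
  have hx1 : m * (x : ℕ) < (p + 1) * L := by rw [add_mul]; omega
  have hy1 : m * (y : ℕ) < (q + 1) * L := by rw [add_mul]; omega
  have e1 : (p + 2) * L ≤ q * L := Nat.mul_le_mul_right _ hpq
  have e2 : (q + 2) * L ≤ (p + m) * L := Nat.mul_le_mul_right _ hqp
  have hxy : (x : ℕ) ≤ y := by
    by_contra h
    have := Nat.mul_le_mul_left m (not_le.1 h).le
    nlinarith
  have hdist : Nat.dist x y = y - x := Nat.dist_eq_sub_of_le hxy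
  have k : ∀ t : ℕ, L < m * t → ℓ < t := fun t ht => by
    have : (L : ℝ) < m * t := by exact_mod_cast ht
    have hm' : (0 : ℝ) < m := by exact_mod_cast hm
    exact lt_of_mul_lt_mul_left (hL.trans_lt this) hm'.le
  have k1 : L < m * (y - x : ℕ) := by
    rw [Nat.mul_sub]
    have : m * (x : ℕ) + L < m * y := by nlinarith
    omega
  have k2 : L < m * (L - (y - x : ℕ)) := by
    have hle : (y : ℕ) - x ≤ L := by omega
    zify [hle, hxy]
    zify at hx hy1 e2
    nlinarith
  unfold coordDist
  rw [hdist]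
  cases b
  · simpa using k _ k1
  · simp only [if_true, Nat.cast_min, lt_min_iff]
    exact ⟨k _ k1, k _ k2⟩

theorem disjoint_slab_nbhd (periodic : Fin D → Bool) {ℓ : ℝ} (i : Fin D) {m p q : ℕ}
    (hm : 0 < m) (hL : (m : ℝ) * ℓ ≤ L)
    (h : p + 2 ≤ q ∧ q + 2 ≤ p + m ∨ q + 2 ≤ p ∧ p + 2 ≤ q + m) :
    Disjoint (slab (L := L) i m p) (nbhd periodic ℓ (slab i m q)) := by
  rw [Finset.disjoint_left]
  intro y hy hy'
  obtain ⟨-, x, hx, hxy⟩ := Finset.mem_filter.1 hy'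
  have hx' := (Finset.mem_filter.1 hx).2
  have hy' := (Finset.mem_filter.1 hy).2
  have h1 := (coordDist_le_siteDist periodic x y i).trans hxy
  rcases h with h | h
  · rw [coordDist_comm] at h1
    exact absurd (lt_coordDist hm hL (periodic i) hy' hx' h.1 h.2) (not_lt.2 h1)
  · exact absurd (lt_coordDist hm hL (periodic i) hx' hy' h.1 h.2) (not_lt.2 h1)

end Slabs

theorem IsRecoverable.mono {V : Type*} [Fintype V] [DecidableEq V] {C : Code V} {δ δ' : ℝ}
    {A N : Finset V} (h : IsRecoverable C δ A N) (hδ : δ ≤ δ') : IsRecoverable C δ' A N := by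
  obtain ⟨Φ, hΦ, hr⟩ := h
  exact ⟨Φ, hΦ, fun ρ hρ r ψ hψ => (hr ρ hρ r ψ hψ).trans hδ⟩

/-! ### Regions that cannot be correctable -/

section Distance

variable {D L : ℕ} {periodic : Fin D → Bool} {ℓ δ : ℝ} {C : Code (Site D L)}

/-- Cleaning the whole lattice against the empty region would require `2 ≤ 6 · 81/250 = 1.944`. -/
theorem not_isCorrectable_univ (hℓ : 1 ≤ ℓ) (hL : ℓ ≤ L) (hC : 1 < Module.finrank ℂ C)
    (hδ : 10 * (L : ℝ) * δ < ℓ) : ¬ IsCorrectable periodic C δ ℓ Finset.univ := by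
  intro h
  have hL0 : (0 : ℝ) < L := by linarith
  have h10 : δ ≤ 1 / 10 := by nlinarith
  have hc := isCleanable_biUnion (A := fun _ : Unit => (Finset.univ : Finset (Site D L)))
    (N := fun _ => nbhd periodic ℓ Finset.univ) (δ := 1 / 10) (by norm_num) le_rfl {()}
    (fun _ _ => subset_nbhd periodic (by linarith) _) (fun _ _ => IsRecoverable.mono h h10)
    (fun _ _ _ _ hne => absurd rfl hne)
  have he : IsCleanable C ∅ 0 := fun O hO => ⟨O, hO, actsTrivially_empty O, by simp⟩
  have := cleaning_tradeoff hC (by simp) he hc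
  norm_num at this

theorem exists_card_le_not_isCorrectable (hD : 1 ≤ D) (hℓ : 1 ≤ ℓ) (hL : 5 * ℓ < L)
    (hC : 1 < Module.finrank ℂ C) (hδ : 10 * (L : ℝ) * δ < ℓ) :
    ∃ A : Finset (Site D L), (A.card : ℝ) ≤ 5 * ℓ * (L : ℝ) ^ (D - 1) ∧
      ¬ IsCorrectable periodic C δ ℓ A := by
  by_contra! hcon
  have hL0 : (0 : ℝ) < L := by linarith
  -- The hypothesis on `δ` gives `δ < δ'`; unlike `δ`, this bound is certainly positive.
  set δ' := ℓ / (10 * L) with hδ'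
  have hδδ' : δ ≤ δ' := by rw [hδ', le_div_iff₀ (by positivity)]; linarith
  have hδ'0 : 0 < δ' := by positivity
  have hδ'1 : δ' ≤ 1 / 10 := by rw [hδ', div_le_iff₀ (by positivity)]; linarith
  -- Then `2N` slabs have width `L/(2N)` at least `2ℓ`, and at most `4ℓ` because `L < 4ℓ(N + 1) ≤
  -- 8ℓN`. Rounding adds one layer, so `4ℓ + 1 ≤ 5ℓ`. An even number of slabs keeps equal parities
  -- apart across a periodic boundary.
  set N := ⌊(L : ℝ) / (4 * ℓ)⌋₊ with hN
  have hN1 : 4 * ℓ * N ≤ L := by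
    have := Nat.floor_le (a := (L : ℝ) / (4 * ℓ)) (by positivity)
    rw [← hN, le_div_iff₀ (by positivity)] at this
    linarith
  have hN2 : (L : ℝ) < 4 * ℓ * (N + 1) := by
    have := Nat.lt_floor_add_one ((L : ℝ) / (4 * ℓ))
    rw [← hN, div_lt_iff₀ (by positivity)] at this
    linarith
  have hN0 : 0 < N := by
    rw [hN, Nat.floor_pos, le_div_iff₀ (by positivity)]
    linarith
  have hN0' : (1 : ℝ) ≤ N := by exact_mod_cast hN0
  have hm : 0 < 2 * N := by omega
  let i : Fin D := ⟨0, hD⟩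
  have hcorr : ∀ j, IsRecoverable C δ' (slab i (2 * N) j)
      (nbhd periodic ℓ (slab i (2 * N) j)) := fun j => by
    refine IsRecoverable.mono (hcon _ ?_) hδδ'
    have h1 : ((slab (L := L) i (2 * N) j).card : ℝ)
        ≤ ((L / (2 * N) : ℕ) + 1 : ℝ) * (L : ℝ) ^ (D - 1) := by
      exact_mod_cast card_slab_le (L := L) i hm j
    refine h1.trans (mul_le_mul_of_nonneg_right ?_ (by positivity))
    have h2 : ((L / (2 * N) : ℕ) : ℝ) ≤ (L : ℝ) / (2 * N : ℕ) := Nat.cast_div_le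
    have h3 : (L : ℝ) / (2 * N : ℕ) ≤ 4 * ℓ := by
      rw [div_le_iff₀ (by exact_mod_cast hm)]
      push_cast
      nlinarith
    linarith
  have hmL : ((2 * N : ℕ) : ℝ) * ℓ ≤ L := by
    push_cast
    nlinarith
  have hclean : ∀ c : ℕ, IsCleanable C ((Finset.range N).biUnion fun j => slab i (2 * N) (2 * j + c))
      (N * (81 / 25 * δ')) := fun c => by
    have := isCleanable_biUnion hδ'0 hδ'1 (Finset.range N)
      (A := fun j => slab i (2 * N) (2 * j + c))
      (N := fun j => nbhd periodic ℓ (slab i (2 * N) (2 * j + c)))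
      (fun j _ => subset_nbhd periodic (by linarith) _) (fun j _ => hcorr _)
      (fun j hj k hk hne => disjoint_slab_nbhd periodic i hm hmL (by
        have := Finset.mem_range.1 hj
        have := Finset.mem_range.1 hk
        omega))
    rwa [Finset.card_range] at this
  have hcover : ((Finset.range N).biUnion fun j => slab (L := L) i (2 * N) (2 * j + 0)) ∪
      ((Finset.range N).biUnion fun j => slab i (2 * N) (2 * j + 1)) = Finset.univ := by
    refine Finset.eq_univ_of_forall fun x => ?_
    have hLn : 0 < L := (x i).pos
    have hk : 2 * N * (x i : ℕ) / L < 2 * N := by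
      rw [Nat.div_lt_iff_lt_mul hLn]
      exact Nat.mul_lt_mul_of_pos_left (x i).isLt hm
    simp only [Finset.mem_union, Finset.mem_biUnion, Finset.mem_range, slab, Finset.mem_filter,
      Finset.mem_univ, true_and]
    rcases Nat.even_or_odd' (2 * N * (x i : ℕ) / L) with ⟨j, hj | hj⟩
    · exact Or.inl ⟨j, by omega, by omega⟩
    · exact Or.inr ⟨j, by omega, by omega⟩
  -- Each family costs at most `(81/25)/40 = 0.081`, and `15 · 0.081 < 2`.
  have hfin := cleaning_tradeoff hC hcover (hclean 0) (hclean 1)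
  have hNδ : N * δ' ≤ 1 / 40 := by
    rw [hδ', ← mul_div_assoc, div_le_iff₀ (by positivity)]
    linarith
  linarith

end Distance

end LocalAQEC

/-! ### The bound on the code distance and its existence -/

theorem mainTheorem3 (D L : ℕ) (hD : 1 ≤ D) (periodic : Fin D → Bool) (δ ℓ : ℝ) (hℓ : 1 ≤ ℓ)
    (C : Code (Site D L)) (hC : 1 < Module.finrank ℂ C) (hδ : 10 * (L : ℝ) * δ < ℓ) :
    (∀ d : ℕ, IsCodeDistance periodic C δ ℓ d → (d : ℝ) ≤ 5 * ℓ * (L : ℝ) ^ (D - 1)) ∧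
      (ℓ ≤ (L : ℝ) → ∃ d : ℕ, IsCodeDistance periodic C δ ℓ d) := by
  constructor
  · intro d hd
    by_contra! hlt
    have hdL : d ≤ L ^ D := by
      by_contra! hlt'
      have hcard : ∀ A : Finset (Site D L), A.card < d := fun A =>
        (Finset.card_le_univ A).trans_lt (by simpa using hlt')
      -- For `d > L^D` every region is already correctable, so `d + 1` would qualify too and no
      -- largest value would exist.
      have : d + 1 ≤ d := hd.2 fun A _ => hd.1 A (hcard A)
      omega
    have hL : 5 * ℓ < L := by
      have h1 : (d : ℝ) ≤ (L : ℝ) * (L : ℝ) ^ (D - 1) := by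
        rw [← pow_succ', Nat.sub_add_cancel hD]
        exact_mod_cast hdL
      exact lt_of_mul_lt_mul_right (hlt.trans_le h1) (by positivity)
    obtain ⟨A, hA, hA'⟩ := exists_card_le_not_isCorrectable (periodic := periodic) hD hℓ hL hC hδ
    exact hA' (hd.1 A (by exact_mod_cast hA.trans_lt hlt))
  · intro hL
    have hbdd : BddAbove {d : ℕ | ∀ A : Finset (Site D L), A.card < d →
        IsCorrectable periodic C δ ℓ A} := by
      refine ⟨(Finset.univ : Finset (Site D L)).card, fun d hd => ?_⟩
      by_contra! hlt
      exact not_isCorrectable_univ hℓ hL hC hδ (hd _ hlt)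
    -- The admissible integers contain `0` vacuously and are bounded by the number of sites, since
    -- the whole lattice is not correctable.
    exact ⟨_, Nat.sSup_mem ⟨0, fun A hA => absurd hA (Nat.not_lt_zero _)⟩ hbdd,
      fun d hd => le_csSup hbdd hd⟩
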